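/- Identify the plane with $\mathbb{R}^2$ with its Euclidean norm. A *Kepler orbit* is a conic with a focus at the origin: a circle centred at the origin, a non-circular ellipse, a parabola, or, for a hyperbola, only the branch bending around the origin. Let $\gamma:\mathbb{R}\to\mathbb{R}^2$ be a smooth simple closed curve (periodic with period $T>0$ and injective on $[0,T)$) which is star-shaped about the origin and strictly convex, i.e. for every $t$ the vectors $\gamma(t),\gamma'(t)$ are linearly independent and the vectors $\gamma'(t),\gamma''(t)$ are linearly independent. Say that $\gamma$ has contact of order at least $k$ at $t$ with a plane curve $C$ if there is a smooth parametrized curve $\sigma$, defined near $t$ with values in $C$, such that $\sigma^{(j)}(t)=\gamma^{(j)}(t)$ for $0\le j\le k$. An *osculating Kepler orbit* of $\gamma$ at $t$ is a Kepler orbit with which $\gamma$ has contact of order at least $2$ at $t$, and $\gamma(t)$ is a *Kepler vertex* if an osculating Kepler orbit at $t$ is hyperosculating, i.e. has contact of order at least $3$ with $\gamma$ at $t$. **Theorem.** At every $t$ the curve $\gamma$ has exactly one osculating Kepler orbit. There are at least four distinct points of $\gamma$ that are Kepler vertices. Along any vertex-free arc of $\gamma$ (i.e. for parameters in an interval $I\subseteq\mathbb{R}$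 containing no parameter of a Kepler vertex), the osculating Kepler orbits at distinct parameters are pairwise disjoint and nested: of any two of them, one lies, together with its inside, in the inside of the other, where the inside of a Kepler orbit is the connected component of its complement containing the origin. -/

import Mathlib

open Filter Topology
open scoped ContDiff

/-- The Euclidean plane. -/
abbrev Plane : Type := EuclideanSpace ℝ (Fin 2)

/-- The circle of radius `R` centred at the origin. -/
def centeredCircle (R : ℝ) : Set Plane := {p | ‖p‖ = R}

/-- For a unit vector `n` and `d, e > 0`: the non-circular conic of eccentricity `e` with a focus
at the origin and directrix the line `⟪n, p⟫ = d`; if `e > 1`, only its branch around the focus.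
On the side of the directrix that contains the origin, the distance from `p` to the directrix is
`d - ⟪n, p⟫`. On the other side `d - ⟪n, p⟫ < 0`, so the equation has no solutions there: for
`e ≤ 1` the conic has no points on that side, and for `e > 1` this discards exactly the
branch of the hyperbola that is separated from the focus by the directrix. -/
def focusDirectrixConic (n : Plane) (d e : ℝ) : Set Plane :=
  {p | ‖p‖ = e * (d - inner ℝ n p)}

/-- A Kepler orbit: a conic (circle, non-circular ellipse, parabola, or the branch of a hyperbola
bending around the origin) with a focus at the origin. -/
def IsKeplerOrbit (C : Set Plane) : Prop :=
  (∃ R : ℝ, 0 < R ∧ C = centeredCircle R) ∨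
    ∃ (n : Plane) (d e : ℝ), ‖n‖ = 1 ∧ 0 < d ∧ 0 < e ∧ C = focusDirectrixConic n d e

/-- The parametrized curve `γ` has contact of order at least `k` at the parameter `t` with the
plane curve `C`: near that point, `C` contains a smooth parametrized curve whose derivatives at `t`
up to order `k` are those of `γ`. (When `γ' t ≠ 0` and `k ≥ 1`, this curve is regular
at `t`.) -/
def HasContact (k : ℕ) (γ : ℝ → Plane) (t : ℝ) (C : Set Plane) : Prop :=
  ∃ σ : ℝ → Plane, ContDiffAt ℝ ∞ σ t ∧ (∀ᶠ s in 𝓝 t, σ s ∈ C) ∧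
    ∀ j ≤ k, iteratedDeriv j σ t = iteratedDeriv j γ t

/-- `C` is a Kepler orbit tangent to `γ` to second order at the parameter `t`. -/
def IsOsculatingKeplerOrbit (γ : ℝ → Plane) (t : ℝ) (C : Set Plane) : Prop :=
  IsKeplerOrbit C ∧ HasContact 2 γ t C

/-- The osculating Kepler orbit at `t` is hyperosculating: tangent to order higher than two. -/
def IsKeplerVertex (γ : ℝ → Plane) (t : ℝ) : Prop :=
  ∃ C, IsOsculatingKeplerOrbit γ t C ∧ HasContact 3 γ t C

/-- A smooth simple closed plane curve, parametrized with period `T`, that is star-shaped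
about the origin (`γ, γ'` linearly independent) and strictly convex (`γ', γ''` linearly
independent). -/
structure IsStrictlyConvexStarShapedClosedCurve (γ : ℝ → Plane) (T : ℝ) : Prop where
  smooth : ContDiff ℝ ∞ γ
  period_pos : 0 < T
  periodic : Function.Periodic γ T
  simple : Set.InjOn γ (Set.Ico 0 T)
  starShaped : ∀ t, LinearIndependent ℝ ![γ t, deriv γ t]
  strictlyConvex : ∀ t, LinearIndependent ℝ ![deriv γ t, iteratedDeriv 2 γ t]

/-- The region inside a Kepler orbit: the connected component of its complement that contains
the focus (the origin). -/
def insideOf (C : Set Plane) : Set Plane := connectedComponentIn Cᶜ 0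

/-- One of the two curves lies, together with its inside, inside the other. -/
def AreNested (C D : Set Plane) : Prop :=
  C ∪ insideOf C ⊆ insideOf D ∨ D ∪ insideOf D ⊆ insideOf C

/-!
In terms of the distance `‖p‖` to the origin, a Kepler orbit is a level set
`k ‖p‖ - (a p₀ + b p₁) = 1` with `k > 0`, where `1 / k` is the semi-latus rectum
(`isKeplerOrbit_iff`). Second-order contact with `γ` is a linear system for `(k, a, b)`. Strict
convexity makes it uniquely solvable, with solution `oscK`, `oscA`, `oscB`, and `k > 0` because
this holds at the point of `γ` farthest from the origin (`oscK_pos`,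
`isOsculatingKeplerOrbit_iff`).

Everything else rests on one formula: with `u = γ / ‖γ‖`, differentiation in the parameter gives
`(a, b)' = k' u` (`hasDerivAt_oscA`, `hasDerivAt_oscB`).

* If `k' = 0`, then `(k, a, b)` is stationary, and differentiating the second-order contact
  condition shows that the contact has order three, so that the point is a vertex
  (`osc_deriv_three`).
* For a fixed point `p ≠ 0` the value `k ‖p‖ - (a, b) ⬝ p` has derivative `k' (‖p‖ - u ⬝ p)`. On a
  vertex-free arc `k'` has constant sign, so this value is strictly monotone in the parameter
  (`oscGauge_lt`). As the inside of an orbit is where its gauge is less than `1`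
  (`insideOf_keplerGauge`), the orbits are disjoint and nested.
* For constants `A`, `B`, `C` the periodic function `A k + B a + C b` has derivative
  `k' (A + B u₀ + C u₁)`, the product of `k'` and a trigonometric polynomial of degree at most one
  in the polar angle. A simple curve winds around the origin only once
  (`IsPolarAngle.le_two_pi`), so if `k'` had at most three zeros on the curve, such a polynomial
  could be chosen with the sign pattern of `k'`, and a periodic function would be strictly
  monotone (`not_deriv_oscK_ne_zero_of_three`).
-/

/-! ### Coordinates of a smooth plane curve -/

theorem Plane.norm_sq (p : Plane) : ‖p‖ ^ 2 = p 0 ^ 2 + p 1 ^ 2 := by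
  rw [EuclideanSpace.real_norm_sq_eq, Fin.sum_univ_two]

theorem hasDerivAt_iteratedDeriv_apply {γ : ℝ → Plane} (hγ : ContDiff ℝ ∞ γ) (j : ℕ) (i : Fin 2)
    (t : ℝ) : HasDerivAt (fun s => iteratedDeriv j γ s i) (iteratedDeriv (j + 1) γ t i) t := by
  have h : HasDerivAt (iteratedDeriv j γ) (iteratedDeriv (j + 1) γ t) t := by
    rw [iteratedDeriv_succ]
    exact (hγ.differentiable_iteratedDeriv j (by exact_mod_cast ENat.natCast_lt_top j) t).hasDerivAt
  exact (EuclideanSpace.proj (𝕜 := ℝ) i).hasFDerivAt.comp_hasDerivAt t h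

theorem contDiff_iteratedDeriv_apply {γ : ℝ → Plane} (hγ : ContDiff ℝ ∞ γ) (j : ℕ) (i : Fin 2) :
    ContDiff ℝ ∞ (fun s => iteratedDeriv j γ s i) := by
  have h : ContDiff ℝ ∞ (iteratedDeriv j γ) := by
    rw [iteratedDeriv_eq_iterate]
    exact hγ.iterate_deriv j
  exact (contDiff_euclidean.1 h) i

/-- The determinant of the position vector and the `j`-th derivative of the curve. -/
noncomputable def posDet (γ : ℝ → Plane) (j : ℕ) (t : ℝ) : ℝ :=
  γ t 0 * iteratedDeriv j γ t 1 - γ t 1 * iteratedDeriv j γ t 0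

/-- The determinant of the first two derivatives of the curve. -/
noncomputable def velDet (γ : ℝ → Plane) (t : ℝ) : ℝ :=
  iteratedDeriv 1 γ t 0 * iteratedDeriv 2 γ t 1 - iteratedDeriv 1 γ t 1 * iteratedDeriv 2 γ t 0

theorem det_ne_zero_of_linearIndependent {p q : Plane} (h : LinearIndependent ℝ ![p, q]) :
    p 0 * q 1 - p 1 * q 0 ≠ 0 := by
  intro h0
  rw [LinearIndependent.pair_iff] at h
  have h1 := h (q 1) (-p 1) (by
    ext i; fin_cases i <;> simp <;> linarith)
  have h2 := h (q 0) (-p 0) (by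
    ext i; fin_cases i <;> simp <;> linarith)
  have hp : (0 : ℝ) = 1 := by
    refine absurd (h 1 0 ?_).1 one_ne_zero
    ext i; fin_cases i
    · simpa using h2.2
    · simpa using h1.2
  exact zero_ne_one hp

theorem IsStrictlyConvexStarShapedClosedCurve.posDet_ne_zero {γ : ℝ → Plane} {T : ℝ}
    (hγ : IsStrictlyConvexStarShapedClosedCurve γ T) (t : ℝ) : posDet γ 1 t ≠ 0 := by
  simpa [posDet, iteratedDeriv_one] using det_ne_zero_of_linearIndependent (hγ.starShaped t)

theorem IsStrictlyConvexStarShapedClosedCurve.velDet_ne_zero {γ : ℝ → Plane} {T : ℝ}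
    (hγ : IsStrictlyConvexStarShapedClosedCurve γ T) (t : ℝ) : velDet γ t ≠ 0 := by
  simpa [velDet, iteratedDeriv_one] using det_ne_zero_of_linearIndependent (hγ.strictlyConvex t)

theorem norm_pos_of_posDet_ne_zero {γ : ℝ → Plane} {j : ℕ} {t : ℝ} (h : posDet γ j t ≠ 0) :
    0 < ‖γ t‖ := by
  refine norm_pos_iff.2 fun h0 => h ?_
  simp [posDet, h0]

theorem hasDerivAt_apply {γ : ℝ → Plane} (hγ : ContDiff ℝ ∞ γ) (i : Fin 2) (t : ℝ) :
    HasDerivAt (fun s => γ s i) (iteratedDeriv 1 γ t i) t := by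
  simpa [iteratedDeriv_zero] using hasDerivAt_iteratedDeriv_apply hγ 0 i t

theorem hasDerivAt_posDet {γ : ℝ → Plane} (hγ : ContDiff ℝ ∞ γ) (t : ℝ) :
    HasDerivAt (posDet γ 1) (posDet γ 2 t) t := by
  have h := ((hasDerivAt_apply hγ 0 t).mul (hasDerivAt_iteratedDeriv_apply hγ 1 1 t)).sub
    ((hasDerivAt_apply hγ 1 t).mul (hasDerivAt_iteratedDeriv_apply hγ 1 0 t))
  refine h.congr_deriv ?_
  simp only [posDet]
  ring

/-- The inner product of the position and the velocity. -/
noncomputable def posVel (γ : ℝ → Plane) (t : ℝ) : ℝ :=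
  γ t 0 * iteratedDeriv 1 γ t 0 + γ t 1 * iteratedDeriv 1 γ t 1

/-- The derivative of `posVel`. -/
noncomputable def posVelDeriv (γ : ℝ → Plane) (t : ℝ) : ℝ :=
  iteratedDeriv 1 γ t 0 ^ 2 + γ t 0 * iteratedDeriv 2 γ t 0 +
    (iteratedDeriv 1 γ t 1 ^ 2 + γ t 1 * iteratedDeriv 2 γ t 1)

theorem hasDerivAt_posVel {γ : ℝ → Plane} (hγ : ContDiff ℝ ∞ γ) (t : ℝ) :
    HasDerivAt (posVel γ) (posVelDeriv γ t) t := by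
  have h := ((hasDerivAt_apply hγ 0 t).mul (hasDerivAt_iteratedDeriv_apply hγ 1 0 t)).add
    ((hasDerivAt_apply hγ 1 t).mul (hasDerivAt_iteratedDeriv_apply hγ 1 1 t))
  refine h.congr_deriv ?_
  simp only [posVelDeriv]
  ring

theorem hasDerivAt_norm_sq {γ : ℝ → Plane} (hγ : ContDiff ℝ ∞ γ) (t : ℝ) :
    HasDerivAt (fun s => ‖γ s‖ ^ 2) (2 * posVel γ t) t := by
  have h := ((hasDerivAt_apply hγ 0 t).pow 2).add ((hasDerivAt_apply hγ 1 t).pow 2)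
  refine (h.congr_of_eventuallyEq (.of_forall fun s => ?_)).congr_deriv ?_
  · exact Plane.norm_sq (γ s)
  · simp only [posVel]
    push_cast
    ring

theorem hasDerivAt_norm {γ : ℝ → Plane} (hγ : ContDiff ℝ ∞ γ) {t : ℝ} (h0 : 0 < ‖γ t‖) :
    HasDerivAt (fun s => ‖γ s‖) (posVel γ t / ‖γ t‖) t := by
  have h := (hasDerivAt_norm_sq hγ t).sqrt (by positivity)
  simp only [Real.sqrt_sq (norm_nonneg _)] at h
  refine h.congr_deriv ?_
  field_simp

/-- The second derivative of the distance to the origin along a curve. -/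
noncomputable def normDeriv₂ (γ : ℝ → Plane) (t : ℝ) : ℝ :=
  posVelDeriv γ t / ‖γ t‖ - posVel γ t ^ 2 / ‖γ t‖ ^ 3

theorem hasDerivAt_posVel_div_norm {γ : ℝ → Plane} (hγ : ContDiff ℝ ∞ γ) {t : ℝ}
    (h0 : 0 < ‖γ t‖) : HasDerivAt (fun s => posVel γ s / ‖γ s‖) (normDeriv₂ γ t) t := by
  refine ((hasDerivAt_posVel hγ t).div (hasDerivAt_norm hγ h0) h0.ne').congr_deriv ?_
  simp only [normDeriv₂]
  field_simp

theorem contDiff_norm_curve {γ : ℝ → Plane} (hγ : ContDiff ℝ ∞ γ) (h0 : ∀ t, 0 < ‖γ t‖) :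
    ContDiff ℝ ∞ (fun s => ‖γ s‖) :=
  hγ.norm ℝ fun t => norm_pos_iff.1 (h0 t)

theorem contDiff_apply_curve {γ : ℝ → Plane} (hγ : ContDiff ℝ ∞ γ) (i : Fin 2) :
    ContDiff ℝ ∞ (fun s => γ s i) :=
  contDiff_euclidean.1 hγ i

theorem contDiff_normDeriv₂ {γ : ℝ → Plane} (hγ : ContDiff ℝ ∞ γ) (h0 : ∀ t, 0 < ‖γ t‖) :
    ContDiff ℝ ∞ (normDeriv₂ γ) := by
  have hr := contDiff_norm_curve hγ h0
  have h2 (i) := contDiff_iteratedDeriv_apply hγ 2 i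
  have h1 (i) := contDiff_iteratedDeriv_apply hγ 1 i
  have h (i) := contDiff_apply_curve hγ i
  have hS : ContDiff ℝ ∞ (posVel γ) := ((h 0).mul (h1 0)).add ((h 1).mul (h1 1))
  have hS' : ContDiff ℝ ∞ (posVelDeriv γ) :=
    (((h1 0).pow 2).add ((h 0).mul (h2 0))).add (((h1 1).pow 2).add ((h 1).mul (h2 1)))
  exact (hS'.div hr fun t => (h0 t).ne').sub
    ((hS.pow 2).div (hr.pow 3) fun t => (pow_pos (h0 t) 3).ne')

/-! ### The coefficients of the osculating Kepler orbit -/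

/-- The function whose level set at height `1` is the Kepler orbit with semi-latus rectum `1 / k`
and eccentricity vector `-(a, b) / k`. It is positively homogeneous. -/
noncomputable def keplerGauge (k a b : ℝ) (p : Plane) : ℝ := k * ‖p‖ - (a * p 0 + b * p 1)

/-- The reciprocal of the semi-latus rectum of the osculating Kepler orbit. As a function of the
polar angle it is `ρ + ρ''` with `ρ = 1 / ‖γ‖`. -/
noncomputable def oscK (γ : ℝ → Plane) (t : ℝ) : ℝ := ‖γ t‖ ^ 3 * velDet γ t / posDet γ 1 t ^ 3

/-- The first linear coefficient of the gauge of the osculating Kepler orbit. The vector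
`(oscA, oscB)` is `oscK • γ / ‖γ‖` plus the velocity rotated by a right angle and divided by
`posDet γ 1`. -/
noncomputable def oscA (γ : ℝ → Plane) (t : ℝ) : ℝ :=
  oscK γ t * (γ t 0 / ‖γ t‖) - iteratedDeriv 1 γ t 1 / posDet γ 1 t

/-- The second linear coefficient of the gauge of the osculating Kepler orbit. -/
noncomputable def oscB (γ : ℝ → Plane) (t : ℝ) : ℝ :=
  oscK γ t * (γ t 1 / ‖γ t‖) + iteratedDeriv 1 γ t 0 / posDet γ 1 t

theorem contDiff_oscK {γ : ℝ → Plane} (hγ : ContDiff ℝ ∞ γ) (hw : ∀ t, posDet γ 1 t ≠ 0) :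
    ContDiff ℝ ∞ (oscK γ) := by
  have h0 (t) := norm_pos_of_posDet_ne_zero (hw t)
  have hr := contDiff_norm_curve hγ h0
  have h2 (i) := contDiff_iteratedDeriv_apply hγ 2 i
  have h1 (i) := contDiff_iteratedDeriv_apply hγ 1 i
  have h (i) := contDiff_apply_curve hγ i
  have hP : ContDiff ℝ ∞ (posDet γ 1) := ((h 0).mul (h1 1)).sub ((h 1).mul (h1 0))
  have hV : ContDiff ℝ ∞ (velDet γ) := ((h1 0).mul (h2 1)).sub ((h1 1).mul (h2 0))
  exact ((hr.pow 3).mul hV).div (hP.pow 3) fun t => pow_ne_zero 3 (hw t)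

theorem hasDerivAt_oscK {γ : ℝ → Plane} (hγ : ContDiff ℝ ∞ γ) (hw : ∀ t, posDet γ 1 t ≠ 0)
    (t : ℝ) : HasDerivAt (oscK γ) (deriv (oscK γ) t) t :=
  ((contDiff_oscK hγ hw).differentiable (by simp) t).hasDerivAt

/-- The unit vector `γ / ‖γ‖` turns with angular velocity `posDet γ 1 / ‖γ‖ ^ 2`. -/
theorem hasDerivAt_apply_zero_div_norm {γ : ℝ → Plane} (hγ : ContDiff ℝ ∞ γ) {t : ℝ}
    (h0 : 0 < ‖γ t‖) : HasDerivAt (fun s => γ s 0 / ‖γ s‖)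
      (-(posDet γ 1 t / ‖γ t‖ ^ 2 * (γ t 1 / ‖γ t‖))) t := by
  refine ((hasDerivAt_apply hγ 0 t).div (hasDerivAt_norm hγ h0) h0.ne').congr_deriv ?_
  have := Plane.norm_sq (γ t)
  field_simp
  rw [this]
  simp only [posDet, posVel]
  ring

theorem hasDerivAt_apply_one_div_norm {γ : ℝ → Plane} (hγ : ContDiff ℝ ∞ γ) {t : ℝ}
    (h0 : 0 < ‖γ t‖) : HasDerivAt (fun s => γ s 1 / ‖γ s‖)
      (posDet γ 1 t / ‖γ t‖ ^ 2 * (γ t 0 / ‖γ t‖)) t := by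
  refine ((hasDerivAt_apply hγ 1 t).div (hasDerivAt_norm hγ h0) h0.ne').congr_deriv ?_
  have := Plane.norm_sq (γ t)
  field_simp
  rw [this]
  simp only [posDet, posVel]
  ring

/-- The coefficient vector `(a, b)` moves in the direction of the position vector. -/
theorem hasDerivAt_oscA {γ : ℝ → Plane} (hγ : ContDiff ℝ ∞ γ) (hw : ∀ t, posDet γ 1 t ≠ 0)
    (t : ℝ) : HasDerivAt (oscA γ) (deriv (oscK γ) t * (γ t 0 / ‖γ t‖)) t := by
  have h0 := norm_pos_of_posDet_ne_zero (hw t)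
  refine (((hasDerivAt_oscK hγ hw t).mul (hasDerivAt_apply_zero_div_norm hγ h0)).sub
    ((hasDerivAt_iteratedDeriv_apply hγ 1 1 t).div (hasDerivAt_posDet hγ t) (hw t))).congr_deriv ?_
  have hw := hw t
  rw [add_sub_assoc, add_eq_left, oscK]
  field_simp
  simp only [posDet, velDet]
  ring

theorem hasDerivAt_oscB {γ : ℝ → Plane} (hγ : ContDiff ℝ ∞ γ) (hw : ∀ t, posDet γ 1 t ≠ 0)
    (t : ℝ) : HasDerivAt (oscB γ) (deriv (oscK γ) t * (γ t 1 / ‖γ t‖)) t := by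
  have h0 := norm_pos_of_posDet_ne_zero (hw t)
  refine (((hasDerivAt_oscK hγ hw t).mul (hasDerivAt_apply_one_div_norm hγ h0)).add
    ((hasDerivAt_iteratedDeriv_apply hγ 1 0 t).div (hasDerivAt_posDet hγ t) (hw t))).congr_deriv ?_
  have hw := hw t
  rw [add_assoc, add_eq_left, oscK]
  field_simp
  simp only [posDet, velDet]
  ring

/-- The osculating gauge at `t` equals `1` at `γ t`. -/
theorem keplerGauge_osc_self {γ : ℝ → Plane} {t : ℝ} (hw : posDet γ 1 t ≠ 0) :
    keplerGauge (oscK γ t) (oscA γ t) (oscB γ t) (γ t) = 1 := by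
  have h0 := norm_pos_of_posDet_ne_zero hw
  have hn := Plane.norm_sq (γ t)
  have hu : (γ t 0 / ‖γ t‖) * γ t 0 + (γ t 1 / ‖γ t‖) * γ t 1 = ‖γ t‖ := by
    field_simp
    linarith
  have hd : (-iteratedDeriv 1 γ t 1 / posDet γ 1 t) * γ t 0 +
      iteratedDeriv 1 γ t 0 / posDet γ 1 t * γ t 1 = -1 := by
    field_simp
    simp only [posDet]
    ring
  simp only [keplerGauge, oscA, oscB]
  linear_combination (-oscK γ t) * hu - hd

/-- Along the curve, the osculating gauge has vanishing first derivative at the point of contact. -/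
theorem osc_deriv_one {γ : ℝ → Plane} {t : ℝ} (hw : posDet γ 1 t ≠ 0) :
    oscK γ t * (posVel γ t / ‖γ t‖) - (oscA γ t * iteratedDeriv 1 γ t 0 +
      oscB γ t * iteratedDeriv 1 γ t 1) = 0 := by
  have h0 := norm_pos_of_posDet_ne_zero hw
  simp only [oscA, oscB, posVel]
  field_simp
  ring

/-- Along the curve, the osculating gauge has vanishing second derivative at the point of
contact. -/
theorem osc_deriv_two {γ : ℝ → Plane} {t : ℝ} (hw : posDet γ 1 t ≠ 0) :
    oscK γ t * normDeriv₂ γ t - (oscA γ t * iteratedDeriv 2 γ t 0 +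
      oscB γ t * iteratedDeriv 2 γ t 1) = 0 := by
  have h0 := norm_pos_of_posDet_ne_zero hw
  have hn := Plane.norm_sq (γ t)
  have h2 : normDeriv₂ γ t - (γ t 0 / ‖γ t‖ * iteratedDeriv 2 γ t 0 +
      γ t 1 / ‖γ t‖ * iteratedDeriv 2 γ t 1) = posDet γ 1 t ^ 2 / ‖γ t‖ ^ 3 := by
    simp only [normDeriv₂]
    field_simp
    rw [hn]
    simp only [posDet, posVel, posVelDeriv]
    ring
  have hk : oscK γ t * (posDet γ 1 t ^ 2 / ‖γ t‖ ^ 3) = velDet γ t / posDet γ 1 t := by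
    simp only [oscK]
    field_simp
  have hv : velDet γ t / posDet γ 1 t = iteratedDeriv 1 γ t 0 / posDet γ 1 t *
      iteratedDeriv 2 γ t 1 - iteratedDeriv 1 γ t 1 / posDet γ 1 t * iteratedDeriv 2 γ t 0 := by
    simp only [velDet]
    ring
  simp only [oscA, oscB]
  linear_combination oscK γ t * h2 + hk + hv

/-- Where `oscK` is stationary, the osculating gauge has vanishing third derivative along the
curve. This follows by differentiating `osc_deriv_two` in `t`. -/
theorem osc_deriv_three {γ : ℝ → Plane} (hγ : ContDiff ℝ ∞ γ) (hw : ∀ t, posDet γ 1 t ≠ 0)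
    {t : ℝ} (hk : deriv (oscK γ) t = 0) :
    oscK γ t * deriv (normDeriv₂ γ) t - (oscA γ t * iteratedDeriv 3 γ t 0 +
      oscB γ t * iteratedDeriv 3 γ t 1) = 0 := by
  have hR := ((contDiff_normDeriv₂ hγ fun t => norm_pos_of_posDet_ne_zero (hw t)).differentiable
    (by simp) t).hasDerivAt
  have h := ((hasDerivAt_oscK hγ hw t).mul hR).sub
    (((hasDerivAt_oscA hγ hw t).mul (hasDerivAt_iteratedDeriv_apply hγ 2 0 t)).add
      ((hasDerivAt_oscB hγ hw t).mul (hasDerivAt_iteratedDeriv_apply hγ 2 1 t)))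
  have h' := h.unique ((hasDerivAt_const t (0 : ℝ)).congr_of_eventuallyEq
    (.of_forall fun s => osc_deriv_two (hw s)))
  rw [hk] at h'
  linear_combination h'

/-- The first three derivatives of a gauge along a curve. -/
theorem iteratedDeriv_keplerGauge {γ : ℝ → Plane} (hγ : ContDiff ℝ ∞ γ) (h0 : ∀ t, 0 < ‖γ t‖)
    (k a b : ℝ) :
    iteratedDeriv 1 (fun s => keplerGauge k a b (γ s)) = (fun s => k * (posVel γ s / ‖γ s‖) -
      (a * iteratedDeriv 1 γ s 0 + b * iteratedDeriv 1 γ s 1)) ∧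
    iteratedDeriv 2 (fun s => keplerGauge k a b (γ s)) = (fun s => k * normDeriv₂ γ s -
      (a * iteratedDeriv 2 γ s 0 + b * iteratedDeriv 2 γ s 1)) ∧
    iteratedDeriv 3 (fun s => keplerGauge k a b (γ s)) = (fun s => k * deriv (normDeriv₂ γ) s -
      (a * iteratedDeriv 3 γ s 0 + b * iteratedDeriv 3 γ s 1)) := by
  have e1 : iteratedDeriv 1 (fun s => keplerGauge k a b (γ s)) = (fun s =>
      k * (posVel γ s / ‖γ s‖) - (a * iteratedDeriv 1 γ s 0 + b * iteratedDeriv 1 γ s 1)) := by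
    rw [iteratedDeriv_one]
    funext t
    exact (((hasDerivAt_norm hγ (h0 t)).const_mul k).sub (((hasDerivAt_apply hγ 0 t).const_mul a).add
      ((hasDerivAt_apply hγ 1 t).const_mul b))).deriv
  have e2 : iteratedDeriv 2 (fun s => keplerGauge k a b (γ s)) = (fun s => k * normDeriv₂ γ s -
      (a * iteratedDeriv 2 γ s 0 + b * iteratedDeriv 2 γ s 1)) := by
    rw [iteratedDeriv_succ, e1]
    funext t
    exact (((hasDerivAt_posVel_div_norm hγ (h0 t)).const_mul k).sub
      (((hasDerivAt_iteratedDeriv_apply hγ 1 0 t).const_mul a).add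
        ((hasDerivAt_iteratedDeriv_apply hγ 1 1 t).const_mul b))).deriv
  refine ⟨e1, e2, ?_⟩
  rw [iteratedDeriv_succ, e2]
  funext t
  exact ((((contDiff_normDeriv₂ hγ h0).differentiable (by simp) t).hasDerivAt.const_mul k).sub
    (((hasDerivAt_iteratedDeriv_apply hγ 2 0 t).const_mul a).add
      ((hasDerivAt_iteratedDeriv_apply hγ 2 1 t).const_mul b))).deriv

theorem exists_forall_le_of_periodic {f : ℝ → ℝ} {T : ℝ} (hf : Continuous f) (hT : 0 < T)
    (hp : Function.Periodic f T) : ∃ t₀, ∀ t, f t ≤ f t₀ := by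
  obtain ⟨t₀, -, h⟩ := isCompact_Icc.exists_isMaxOn (Set.nonempty_Icc.2 hT.le) hf.continuousOn
  refine ⟨t₀, fun t => ?_⟩
  obtain ⟨s, hs, hst⟩ := hp.exists_mem_Ico₀ hT t
  rw [hst]
  exact h (Set.Ico_subset_Icc_self hs)

theorem deriv_deriv_nonpos_of_isLocalMax {f : ℝ → ℝ} {t : ℝ} (hf : ContinuousAt f t)
    (h : IsLocalMax f t) : deriv (deriv f) t ≤ 0 := by
  by_contra! hpos
  have hmin := isLocalMin_of_deriv_deriv_pos hpos h.deriv_eq_zero hf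
  have hc : f =ᶠ[𝓝 t] fun _ => f t := by
    filter_upwards [h, hmin] with s h1 h2 using le_antisymm h1 h2
  have hd : deriv f =ᶠ[𝓝 t] fun _ => 0 := by simpa using hc.deriv
  rw [hd.deriv_eq] at hpos
  simp at hpos

/-- A continuous function on the line without zeros that is positive somewhere is positive. -/
theorem pos_of_continuous_of_ne_zero {f : ℝ → ℝ} (hf : Continuous f) (h : ∀ t, f t ≠ 0) {t₀ : ℝ}
    (h₀ : 0 < f t₀) (t : ℝ) : 0 < f t := by
  by_contra! hle
  obtain ⟨s, hs⟩ := mem_range_of_exists_le_of_exists_ge hf ⟨t, hle⟩ ⟨t₀, h₀.le⟩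
  exact h s hs

/-- The osculating conic bends around the origin. The sign is read off at the point of the curve
farthest from the origin, and `oscK` has no zeros. -/
theorem IsStrictlyConvexStarShapedClosedCurve.oscK_pos {γ : ℝ → Plane} {T : ℝ}
    (hγ : IsStrictlyConvexStarShapedClosedCurve γ T) (t : ℝ) : 0 < oscK γ t := by
  have hw := hγ.posDet_ne_zero
  have h0 (t) := norm_pos_of_posDet_ne_zero (hw t)
  have hne (t) : oscK γ t ≠ 0 :=
    div_ne_zero (mul_ne_zero (pow_ne_zero 3 (h0 t).ne') (hγ.velDet_ne_zero t)) (pow_ne_zero 3 (hw t))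
  have hcont : Continuous fun s => ‖γ s‖ ^ 2 := hγ.smooth.continuous.norm.pow 2
  obtain ⟨t₀, ht₀⟩ := exists_forall_le_of_periodic hcont hγ.period_pos
    fun s => by simp only [hγ.periodic s]
  have hmax : IsLocalMax (fun s => ‖γ s‖ ^ 2) t₀ := .of_forall ht₀
  have hd : deriv (fun s => ‖γ s‖ ^ 2) = fun s => 2 * posVel γ s :=
    funext fun s => (hasDerivAt_norm_sq hγ.smooth s).deriv
  have h1 : posVel γ t₀ = 0 := by
    have := hmax.deriv_eq_zero
    rw [hd] at this
    linarith
  have h2 : posVelDeriv γ t₀ ≤ 0 := by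
    have := deriv_deriv_nonpos_of_isLocalMax hcont.continuousAt hmax
    rw [hd, ((hasDerivAt_posVel hγ.smooth t₀).const_mul 2).deriv] at this
    linarith
  refine pos_of_continuous_of_ne_zero (contDiff_oscK hγ.smooth hw).continuous hne (t₀ := t₀) ?_ t
  set c := γ t₀ 0 * iteratedDeriv 2 γ t₀ 0 + γ t₀ 1 * iteratedDeriv 2 γ t₀ 1 with hc
  have hn := Plane.norm_sq (γ t₀)
  have key : velDet γ t₀ * ‖γ t₀‖ ^ 2 = posVel γ t₀ * posDet γ 2 t₀ - posDet γ 1 t₀ * c := by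
    rw [hn]
    simp only [velDet, posVel, posDet, hc]
    ring
  rw [h1, zero_mul, zero_sub] at key
  have hc0 : c < 0 := by
    refine lt_of_le_of_ne ?_ fun h => ?_
    · simp only [posVelDeriv] at h2
      nlinarith [sq_nonneg (iteratedDeriv 1 γ t₀ 0), sq_nonneg (iteratedDeriv 1 γ t₀ 1)]
    · rw [h, mul_zero, neg_zero] at key
      exact mul_ne_zero (hγ.velDet_ne_zero t₀) (pow_ne_zero 2 (h0 t₀).ne') key
  have hw₀ := hw t₀
  have hr := h0 t₀
  have : oscK γ t₀ = ‖γ t₀‖ * -c / posDet γ 1 t₀ ^ 2 := by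
    rw [oscK]
    field_simp
    linear_combination key
  rw [this]
  have : 0 < -c := by linarith
  positivity

/-! ### Kepler orbits as level sets -/

theorem keplerGauge_smul (k a b : ℝ) {c : ℝ} (hc : 0 ≤ c) (p : Plane) :
    keplerGauge k a b (c • p) = c * keplerGauge k a b p := by
  simp only [keplerGauge, norm_smul, Real.norm_of_nonneg hc, PiLp.smul_apply, smul_eq_mul]
  ring

theorem keplerGauge_zero (k a b : ℝ) : keplerGauge k a b 0 = 0 := by
  simp [keplerGauge]

theorem continuous_keplerGauge (k a b : ℝ) : Continuous (keplerGauge k a b) := by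
  unfold keplerGauge
  fun_prop

theorem Plane.inner_eq (p q : Plane) : inner ℝ p q = p 0 * q 0 + p 1 * q 1 := by
  rw [PiLp.inner_apply, Fin.sum_univ_two]
  simp [mul_comm]

theorem isKeplerOrbit_iff {C : Set Plane} :
    IsKeplerOrbit C ↔ ∃ k a b : ℝ, 0 < k ∧ C = {p | keplerGauge k a b p = 1} := by
  constructor
  · rintro (⟨R, hR, rfl⟩ | ⟨n, d, e, -, hd, he, rfl⟩)
    · refine ⟨1 / R, 0, 0, by positivity, ?_⟩
      ext p
      simp only [centeredCircle, keplerGauge, Set.mem_ofPred_eq]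
      field_simp
      simp
    · refine ⟨1 / (e * d), -n 0 / d, -n 1 / d, by positivity, ?_⟩
      ext p
      simp only [focusDirectrixConic, keplerGauge, Set.mem_ofPred_eq, Plane.inner_eq]
      field_simp
      constructor <;> intro h <;> linarith
  · rintro ⟨k, a, b, hk, rfl⟩
    by_cases hab : a = 0 ∧ b = 0
    · left
      refine ⟨1 / k, by positivity, ?_⟩
      ext p
      simp only [centeredCircle, keplerGauge, Set.mem_ofPred_eq, hab.1, hab.2]
      field_simp
      constructor <;> intro h <;> linarith
    · right
      have hs : 0 < a ^ 2 + b ^ 2 := by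
        by_contra! h
        exact hab ⟨by nlinarith [sq_nonneg a, sq_nonneg b], by nlinarith [sq_nonneg a, sq_nonneg b]⟩
      set s := √(a ^ 2 + b ^ 2) with hsdef
      have hs0 : 0 < s := Real.sqrt_pos.2 hs
      have hs2 : s ^ 2 = a ^ 2 + b ^ 2 := Real.sq_sqrt hs.le
      refine ⟨!₂[-a / s, -b / s], 1 / s, s / k, ?_, by positivity, by positivity, ?_⟩
      · rw [← sq_eq_sq₀ (norm_nonneg _) zero_le_one, Plane.norm_sq]
        simp only [Matrix.cons_val_zero, Matrix.cons_val_one]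
        field_simp
        linarith
      · ext p
        simp only [focusDirectrixConic, keplerGauge, Set.mem_ofPred_eq, Plane.inner_eq,
          Matrix.cons_val_zero, Matrix.cons_val_one]
        field_simp
        constructor <;> intro h <;> linarith

/-- The inside of a Kepler orbit is the open sublevel set of its gauge: this set is convex, and
the complement of the orbit is the disjoint union of it and the open superlevel set. -/
theorem insideOf_keplerGauge {k : ℝ} (hk : 0 < k) (a b : ℝ) :
    insideOf {p | keplerGauge k a b p = 1} = {p | keplerGauge k a b p < 1} := by
  have hcont := continuous_keplerGauge k a b
  have hconv : Convex ℝ {p | keplerGauge k a b p < 1} := by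
    have h1 : ConvexOn ℝ Set.univ fun p : Plane => k * ‖p‖ := convexOn_univ_norm.smul hk.le
    have h2 : ConcaveOn ℝ Set.univ fun p : Plane => a * p 0 + b * p 1 :=
      ⟨convex_univ, fun x _ y _ c d _ _ _ => le_of_eq (by simp; ring)⟩
    have h3 : ConvexOn ℝ Set.univ (keplerGauge k a b) := h1.sub h2
    have h4 := h3.convex_lt 1
    rwa [Set.sep_univ] at h4
  have h0 : (0 : Plane) ∈ {p | keplerGauge k a b p < 1} := by simp [keplerGauge_zero]
  have hsub : {p | keplerGauge k a b p < 1} ⊆ {p | keplerGauge k a b p = 1}ᶜ :=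
    fun p hp => ne_of_lt hp
  refine Set.Subset.antisymm ?_ (hconv.isPreconnected.subset_connectedComponentIn h0 hsub)
  refine isPreconnected_connectedComponentIn.subset_left_of_subset_union
    (v := {p | 1 < keplerGauge k a b p}) (isOpen_lt hcont continuous_const)
    (isOpen_lt continuous_const hcont) ?_ ?_ ?_
  · exact Set.disjoint_left.2 fun p (h : keplerGauge k a b p < 1) h' => lt_asymm h h'
  · exact fun p hp => lt_or_gt_of_ne (connectedComponentIn_subset _ _ hp)
  · exact ⟨0, mem_connectedComponentIn (hsub h0), h0⟩

/-! ### Contact with Kepler orbits -/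

/-- If the gauge is `1` to order `n` along the curve, then the radial projection of the curve to
the orbit has the same `n`-jet as the curve. -/
theorem hasContact_keplerGauge {γ : ℝ → Plane} (hγ : ContDiff ℝ ∞ γ) {t : ℝ} (ht : γ t ≠ 0)
    {k a b : ℝ} {n : ℕ} (h1 : keplerGauge k a b (γ t) = 1)
    (hn : ∀ j ≤ n, j ≠ 0 → iteratedDeriv j (fun s => keplerGauge k a b (γ s)) t = 0) :
    HasContact n γ t {p | keplerGauge k a b p = 1} := by
  set h : ℝ → ℝ := fun s => keplerGauge k a b (γ s) with hh
  have hhs : ContDiffAt ℝ ∞ h t := by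
    have := contDiff_apply_curve hγ
    exact (contDiffAt_const.mul (hγ.contDiffAt.norm ℝ ht)).sub
      ((contDiffAt_const.mul (this 0).contDiffAt).add (contDiffAt_const.mul (this 1).contDiffAt))
  have hpos : ∀ᶠ s in 𝓝 t, 0 < h s :=
    hhs.continuousAt.eventually (lt_mem_nhds (by rw [hh]; simp [h1]))
  have hσ : ContDiffAt ℝ ∞ (fun s => (h s)⁻¹ • γ s) t :=
    (hhs.inv (by rw [hh]; simp [h1])).smul hγ.contDiffAt
  refine ⟨_, hσ, ?_, fun j hj => ?_⟩
  · filter_upwards [hpos] with s hs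
    show keplerGauge k a b _ = 1
    rw [keplerGauge_smul _ _ _ (inv_nonneg.2 hs.le)]
    exact inv_mul_cancel₀ hs.ne'
  · have he : γ =ᶠ[𝓝 t] h • fun s => (h s)⁻¹ • γ s := by
      filter_upwards [hpos] with s hs
      simp [smul_smul, mul_inv_cancel₀ hs.ne']
    have hj' : (j : WithTop ℕ∞) ≤ ∞ := by exact_mod_cast (ENat.natCast_lt_top j).le
    rw [he.iteratedDeriv_eq, ← iteratedDerivWithin_univ (f := h • _),
      iteratedDerivWithin_smul (Set.mem_univ t) uniqueDiffOn_univ (hhs.of_le hj').contDiffWithinAt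
        (hσ.of_le hj').contDiffWithinAt]
    -- In the Leibniz sum only the term without a derivative of `h` survives.
    rw [Finset.sum_eq_single 0]
    · simp [iteratedDerivWithin_univ, hh, h1]
    · intro i hi hi0
      rw [iteratedDerivWithin_univ, hn i (by grind) hi0]
      simp
    · simp

/-- Second-order contact with an orbit gives three linear equations for its gauge. They are
obtained by differentiating the squared equation `k² ‖p‖² = (1 + a p₀ + b p₁)²`. -/
theorem HasContact.keplerGauge_equations {γ : ℝ → Plane} {t : ℝ} (h0 : 0 < ‖γ t‖) {k a b : ℝ}
    (hk : 0 < k) (h : HasContact 2 γ t {p | keplerGauge k a b p = 1}) :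
    keplerGauge k a b (γ t) = 1 ∧
    k * (posVel γ t / ‖γ t‖) - (a * iteratedDeriv 1 γ t 0 + b * iteratedDeriv 1 γ t 1) = 0 ∧
    k * normDeriv₂ γ t - (a * iteratedDeriv 2 γ t 0 + b * iteratedDeriv 2 γ t 1) = 0 := by
  obtain ⟨σ, hσ, hC, hj⟩ := h
  have j0 : σ t = γ t := by simpa using hj 0 (by norm_num)
  have j1 := hj 1 (by norm_num)
  have j2 := hj 2 le_rfl
  have hval : keplerGauge k a b (γ t) = 1 := by
    rw [← j0]
    exact hC.self_of_nhds
  have hσd : ∀ᶠ s in 𝓝 t, ∀ i, HasDerivAt (fun s => σ s i) (iteratedDeriv 1 σ s i) s := by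
    filter_upwards [(hσ.of_le (m := 1) (by exact_mod_cast le_top)).eventually (by simp)] with s hs i
    rw [iteratedDeriv_one]
    exact (EuclideanSpace.proj (𝕜 := ℝ) i).hasFDerivAt.comp_hasDerivAt s
      (hs.differentiableAt (by simp)).hasDerivAt
  have hσd2 (i) : HasDerivAt (fun s => iteratedDeriv 1 σ s i) (iteratedDeriv 2 σ t i) t := by
    have : HasDerivAt (iteratedDeriv 1 σ) (iteratedDeriv 2 σ t) t := by
      rw [iteratedDeriv_succ (n := 1), iteratedDeriv_one]
      have hle : (1 : WithTop ℕ∞) + 1 ≤ ∞ := by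
        rw [one_add_one_eq_two]
        exact WithTop.coe_le_coe.2 le_top
      refine DifferentiableAt.hasDerivAt ?_
      exact (hσ.derivWithin (m := 1) hle).differentiableAt (by simp)
    exact (EuclideanSpace.proj (𝕜 := ℝ) i).hasFDerivAt.comp_hasDerivAt t this
  have e0 : ∀ᶠ s in 𝓝 t, k ^ 2 * (σ s 0 ^ 2 + σ s 1 ^ 2) - (1 + a * σ s 0 + b * σ s 1) ^ 2 = 0 := by
    filter_upwards [hC] with s hs
    have h1 : k * ‖σ s‖ - (a * σ s 0 + b * σ s 1) = 1 := hs
    rw [← Plane.norm_sq]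
    linear_combination (k * ‖σ s‖ + (1 + a * σ s 0 + b * σ s 1)) * h1
  have e1 : ∀ᶠ s in 𝓝 t, k ^ 2 * (σ s 0 * iteratedDeriv 1 σ s 0 + σ s 1 * iteratedDeriv 1 σ s 1) -
      (1 + a * σ s 0 + b * σ s 1) * (a * iteratedDeriv 1 σ s 0 + b * iteratedDeriv 1 σ s 1) = 0 := by
    filter_upwards [hσd, e0.eventually_nhds] with s hs hz
    have hd := ((((hs 0).pow 2).add ((hs 1).pow 2)).const_mul (k ^ 2)).sub
      (((((hs 0).const_mul a).const_add 1).add ((hs 1).const_mul b)).pow 2)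
    have := hd.unique ((hasDerivAt_const s (0 : ℝ)).congr_of_eventuallyEq hz)
    simp only [Pi.add_apply] at this
    push_cast at this
    linear_combination this / 2
  have e2 : k ^ 2 * posVelDeriv γ t - (a * iteratedDeriv 1 γ t 0 + b * iteratedDeriv 1 γ t 1) ^ 2 -
      (1 + a * γ t 0 + b * γ t 1) * (a * iteratedDeriv 2 γ t 0 + b * iteratedDeriv 2 γ t 1) = 0 := by
    have hs := hσd.self_of_nhds
    have hd := ((((hs 0).mul (hσd2 0)).add ((hs 1).mul (hσd2 1))).const_mul (k ^ 2)).sub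
      (((((hs 0).const_mul a).const_add 1).add ((hs 1).const_mul b)).mul
        (((hσd2 0).const_mul a).add ((hσd2 1).const_mul b)))
    have := hd.unique ((hasDerivAt_const t (0 : ℝ)).congr_of_eventuallyEq e1)
    simp only [Pi.add_apply] at this
    rw [j0, j1, j2] at this
    simp only [posVelDeriv]
    linear_combination this
  have e1' := e1.self_of_nhds
  rw [j0, j1] at e1'
  have hq : 1 + a * γ t 0 + b * γ t 1 = k * ‖γ t‖ := by
    simp only [keplerGauge] at hval
    linarith
  rw [hq] at e1' e2
  have f1 : k * (posVel γ t / ‖γ t‖) -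
      (a * iteratedDeriv 1 γ t 0 + b * iteratedDeriv 1 γ t 1) = 0 := by
    have : k * ‖γ t‖ * (k * (posVel γ t / ‖γ t‖) -
        (a * iteratedDeriv 1 γ t 0 + b * iteratedDeriv 1 γ t 1)) = 0 := by
      simp only [posVel]
      field_simp
      linear_combination e1'
    exact (mul_eq_zero.1 this).resolve_left (by positivity)
  refine ⟨hval, f1, ?_⟩
  have : k * ‖γ t‖ * (k * normDeriv₂ γ t -
      (a * iteratedDeriv 2 γ t 0 + b * iteratedDeriv 2 γ t 1)) = 0 := by
    have e3 : k * ‖γ t‖ * (k * normDeriv₂ γ t) =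
        k ^ 2 * posVelDeriv γ t - (k * (posVel γ t / ‖γ t‖)) ^ 2 := by
      simp only [normDeriv₂]
      field_simp
    rw [mul_sub, e3]
    linear_combination e2 - (k * (posVel γ t / ‖γ t‖) + (a * iteratedDeriv 1 γ t 0 +
      b * iteratedDeriv 1 γ t 1)) * f1
  exact (mul_eq_zero.1 this).resolve_left (by positivity)

/-! ### Existence and uniqueness of the osculating Kepler orbit -/

/-- The osculating Kepler orbit. -/
def oscOrbit (γ : ℝ → Plane) (t : ℝ) : Set Plane :=
  {p | keplerGauge (oscK γ t) (oscA γ t) (oscB γ t) p = 1}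

theorem hasContact_oscOrbit {γ : ℝ → Plane} {T : ℝ}
    (hγ : IsStrictlyConvexStarShapedClosedCurve γ T) (t : ℝ) :
    HasContact 2 γ t (oscOrbit γ t) := by
  have hw := hγ.posDet_ne_zero
  have h0 (t) := norm_pos_of_posDet_ne_zero (hw t)
  refine hasContact_keplerGauge hγ.smooth (norm_pos_iff.1 (h0 t)) (keplerGauge_osc_self (hw t)) ?_
  intro j hj hj0
  obtain ⟨e1, e2, -⟩ := iteratedDeriv_keplerGauge hγ.smooth h0 (oscK γ t) (oscA γ t) (oscB γ t)
  interval_cases j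
  · exact absurd rfl hj0
  · rw [e1]
    exact osc_deriv_one (hw t)
  · rw [e2]
    exact osc_deriv_two (hw t)

theorem hasContact_oscOrbit_of_deriv_eq_zero {γ : ℝ → Plane} {T : ℝ}
    (hγ : IsStrictlyConvexStarShapedClosedCurve γ T) {t : ℝ} (hk : deriv (oscK γ) t = 0) :
    HasContact 3 γ t (oscOrbit γ t) := by
  have hw := hγ.posDet_ne_zero
  have h0 (t) := norm_pos_of_posDet_ne_zero (hw t)
  refine hasContact_keplerGauge hγ.smooth (norm_pos_iff.1 (h0 t)) (keplerGauge_osc_self (hw t)) ?_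
  intro j hj hj0
  obtain ⟨e1, e2, e3⟩ := iteratedDeriv_keplerGauge hγ.smooth h0 (oscK γ t) (oscA γ t) (oscB γ t)
  interval_cases j
  · exact absurd rfl hj0
  · rw [e1]
    exact osc_deriv_one (hw t)
  · rw [e2]
    exact osc_deriv_two (hw t)
  · rw [e3]
    exact osc_deriv_three hγ.smooth hw hk

theorem isOsculatingKeplerOrbit_iff {γ : ℝ → Plane} {T : ℝ}
    (hγ : IsStrictlyConvexStarShapedClosedCurve γ T) {t : ℝ} {C : Set Plane} :
    IsOsculatingKeplerOrbit γ t C ↔ C = oscOrbit γ t := by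
  have hw := hγ.posDet_ne_zero t
  have hK := hγ.oscK_pos t
  constructor
  · rintro ⟨hC, hc⟩
    obtain ⟨k, a, b, hk, rfl⟩ := isKeplerOrbit_iff.1 hC
    obtain ⟨f0, f1, f2⟩ := hc.keplerGauge_equations (norm_pos_of_posDet_ne_zero hw) hk
    have g0 := keplerGauge_osc_self hw
    have g1 := osc_deriv_one hw
    have g2 := osc_deriv_two hw
    have hv := hγ.velDet_ne_zero t
    simp only [keplerGauge] at f0 g0
    simp only [oscOrbit]
    generalize oscK γ t = K at *
    generalize oscA γ t = A at *
    generalize oscB γ t = B at *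
    -- Both gauges satisfy the same linear equations, so that `(a, b) / k` is determined by
    -- the linearly independent vectors `γ'`, `γ''`, and `k` by the value at the point of contact.
    have h1 : (K * a - k * A) * iteratedDeriv 1 γ t 0 +
        (K * b - k * B) * iteratedDeriv 1 γ t 1 = 0 := by
      linear_combination k * g1 - K * f1
    have h2 : (K * a - k * A) * iteratedDeriv 2 γ t 0 +
        (K * b - k * B) * iteratedDeriv 2 γ t 1 = 0 := by
      linear_combination k * g2 - K * f2
    have hA : K * a = k * A := by
      have : (K * a - k * A) * velDet γ t = 0 := by
        simp only [velDet]
        linear_combination iteratedDeriv 2 γ t 1 * h1 - iteratedDeriv 1 γ t 1 * h2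
      exact sub_eq_zero.1 ((mul_eq_zero.1 this).resolve_right hv)
    have hB : K * b = k * B := by
      have : (K * b - k * B) * velDet γ t = 0 := by
        simp only [velDet]
        linear_combination iteratedDeriv 1 γ t 0 * h2 - iteratedDeriv 2 γ t 0 * h1
      exact sub_eq_zero.1 ((mul_eq_zero.1 this).resolve_right hv)
    have hkK : k = K := by
      linear_combination K * f0 - k * g0 + γ t 0 * hA + γ t 1 * hB
    subst hkK
    rw [mul_left_cancel₀ hk.ne' hA, mul_left_cancel₀ hk.ne' hB]
  · rintro rfl
    exact ⟨isKeplerOrbit_iff.2 ⟨_, _, _, hK, rfl⟩, hasContact_oscOrbit hγ t⟩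

/-- Stationary points of the reciprocal semi-latus rectum are Kepler vertices. -/
theorem isKeplerVertex_of_deriv_eq_zero {γ : ℝ → Plane} {T : ℝ}
    (hγ : IsStrictlyConvexStarShapedClosedCurve γ T) {t : ℝ} (hk : deriv (oscK γ) t = 0) :
    IsKeplerVertex γ t :=
  ⟨_, (isOsculatingKeplerOrbit_iff hγ).2 rfl, hasContact_oscOrbit_of_deriv_eq_zero hγ hk⟩

theorem continuous_deriv_oscK {γ : ℝ → Plane} {T : ℝ}
    (hγ : IsStrictlyConvexStarShapedClosedCurve γ T) : Continuous (deriv (oscK γ)) :=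
  (contDiff_oscK hγ.smooth hγ.posDet_ne_zero).continuous_deriv (by simp)

/-! ### Nesting along vertex-free arcs -/

theorem exists_sign_of_continuousOn {f : ℝ → ℝ} {s : Set ℝ} (hs : IsPreconnected s)
    (hf : ContinuousOn f s) (h : ∀ x ∈ s, f x ≠ 0) :
    ∃ ε : ℝ, (ε = 1 ∨ ε = -1) ∧ ∀ x ∈ s, 0 < ε * f x := by
  by_cases hp : ∃ x ∈ s, f x < 0
  · obtain ⟨x, hx, hfx⟩ := hp
    refine ⟨-1, .inr rfl, fun y hy => ?_⟩
    by_contra! hy'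
    obtain ⟨z, hz, hz0⟩ := hs.intermediate_value hx hy hf
      (Set.mem_Icc.2 ⟨hfx.le, by linarith⟩)
    exact h z hz hz0
  · push Not at hp
    exact ⟨1, .inl rfl, fun x hx => by simpa using lt_of_le_of_ne (hp x hx) (h x hx).symm⟩

/-- The unit radial vector satisfies `u ⬝ p ≤ ‖p‖`, and for `p ≠ 0` equality cannot hold on an
open interval because `u` turns. Hence the value of the osculating gauge at `p` is strictly
monotone on vertex-free arcs. -/
theorem oscGauge_lt {γ : ℝ → Plane} {T : ℝ} (hγ : IsStrictlyConvexStarShapedClosedCurve γ T)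
    {s t ε : ℝ} (hst : s < t) (hε : ∀ x ∈ Set.Icc s t, 0 < ε * deriv (oscK γ) x) {p : Plane}
    (hp : p ≠ 0) :
    ε * keplerGauge (oscK γ s) (oscA γ s) (oscB γ s) p <
      ε * keplerGauge (oscK γ t) (oscA γ t) (oscB γ t) p := by
  have hw := hγ.posDet_ne_zero
  have h0 (t) := norm_pos_of_posDet_ne_zero (hw t)
  set D : ℝ → ℝ := fun x => ‖p‖ - (γ x 0 / ‖γ x‖ * p 0 + γ x 1 / ‖γ x‖ * p 1)
  set g : ℝ → ℝ := fun x => ε * keplerGauge (oscK γ x) (oscA γ x) (oscB γ x) p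
  have hu (x) : (γ x 0 / ‖γ x‖) ^ 2 + (γ x 1 / ‖γ x‖) ^ 2 = 1 := by
    have h := h0 x
    field_simp
    exact (Plane.norm_sq _).symm
  have hD (x) : 0 ≤ D x := by
    refine sub_nonneg.2 (abs_le_of_sq_le_sq' ?_ (norm_nonneg p)).2
    rw [Plane.norm_sq p]
    linear_combination (p 0 ^ 2 + p 1 ^ 2) * hu x +
      sq_nonneg (γ x 0 / ‖γ x‖ * p 1 - γ x 1 / ‖γ x‖ * p 0)
  have hg (x) : HasDerivAt g (ε * deriv (oscK γ) x * D x) x := by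
    refine ((((hasDerivAt_oscK hγ.smooth hw x).mul_const ‖p‖).sub
      (((hasDerivAt_oscA hγ.smooth hw x).mul_const (p 0)).add
        ((hasDerivAt_oscB hγ.smooth hw x).mul_const (p 1)))).const_mul ε).congr_deriv ?_
    simp only [D]
    ring
  have hgc : ContinuousOn g (Set.Icc s t) := fun x _ => (hg x).continuousAt.continuousWithinAt
  have hmono : MonotoneOn g (Set.Icc s t) := by
    refine monotoneOn_of_deriv_nonneg (convex_Icc s t) hgc
      (fun x _ => (hg x).differentiableAt.differentiableWithinAt) fun x hx => ?_
    rw [(hg x).deriv]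
    exact mul_nonneg (hε x (interior_subset hx)).le (hD x)
  refine lt_of_le_of_ne (hmono (Set.left_mem_Icc.2 hst.le) (Set.right_mem_Icc.2 hst.le) hst.le) ?_
  intro heq
  have hDz : ∀ x ∈ Set.Ioo s t, D x = 0 := by
    intro x hx
    have hc : g =ᶠ[𝓝 x] fun _ => g s := by
      filter_upwards [Ioo_mem_nhds hx.1 hx.2] with y hy
      have hy' := Set.Ioo_subset_Icc_self hy
      exact le_antisymm ((hmono hy' (Set.right_mem_Icc.2 hst.le) hy'.2).trans_eq heq.symm)
        (hmono (Set.left_mem_Icc.2 hst.le) hy' hy'.1)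
    have := (hg x).unique ((hasDerivAt_const x (g s)).congr_of_eventuallyEq hc)
    exact (mul_eq_zero.1 this).resolve_left (hε x (Set.Ioo_subset_Icc_self hx)).ne'
  have hEz : ∀ x ∈ Set.Ioo s t, γ x 0 / ‖γ x‖ * p 1 - γ x 1 / ‖γ x‖ * p 0 = 0 := by
    intro x hx
    have h1 := hDz x hx
    have hn := Plane.norm_sq p
    simp only [D] at h1
    refine pow_eq_zero_iff two_ne_zero |>.1 ?_
    linear_combination (p 0 ^ 2 + p 1 ^ 2) * hu x - hn + (‖p‖ + (γ x 0 / ‖γ x‖ * p 0 +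
      γ x 1 / ‖γ x‖ * p 1)) * h1
  obtain ⟨x, hx⟩ := Set.nonempty_Ioo.2 hst
  have hd := ((hasDerivAt_apply_zero_div_norm hγ.smooth (h0 x)).mul_const (p 1)).sub
    ((hasDerivAt_apply_one_div_norm hγ.smooth (h0 x)).mul_const (p 0))
  have hd0 := hd.unique ((hasDerivAt_const x (0 : ℝ)).congr_of_eventuallyEq
    (by filter_upwards [Ioo_mem_nhds hx.1 hx.2] with y hy using hEz y hy))
  have h1 := hDz x hx
  simp only [D] at h1
  have : posDet γ 1 x / ‖γ x‖ ^ 2 * ‖p‖ = 0 := by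
    linear_combination -hd0 + posDet γ 1 x / ‖γ x‖ ^ 2 * h1
  exact mul_ne_zero (div_ne_zero (hw x) (pow_ne_zero 2 (h0 x).ne')) (norm_ne_zero_iff.2 hp) this

theorem AreNested.symm {C D : Set Plane} (h : AreNested C D) : AreNested D C :=
  Or.symm h

/-- A pointwise strict inequality of gauges gives disjoint nested orbits. -/
theorem disjoint_and_areNested_of_keplerGauge_lt {k a b k' a' b' : ℝ} (hk : 0 < k) (hk' : 0 < k')
    (h : ∀ p ≠ 0, keplerGauge k a b p < keplerGauge k' a' b' p) :
    Disjoint {p | keplerGauge k a b p = 1} {p | keplerGauge k' a' b' p = 1} ∧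
      AreNested {p | keplerGauge k a b p = 1} {p | keplerGauge k' a' b' p = 1} := by
  have key (p) (hp : keplerGauge k' a' b' p ≤ 1) : keplerGauge k a b p < 1 := by
    by_cases hp0 : p = 0
    · rw [hp0, keplerGauge_zero]
      exact zero_lt_one
    · exact (h p hp0).trans_le hp
  constructor
  · exact Set.disjoint_left.2 fun p (h1 : keplerGauge k a b p = 1) h2 => (key p (le_of_eq h2)).ne h1
  · right
    rw [insideOf_keplerGauge hk, insideOf_keplerGauge hk']
    rintro p (hp | hp)
    · exact key p (le_of_eq hp)
    · exact key p (le_of_lt hp)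

theorem oscOrbit_disjoint_and_areNested {γ : ℝ → Plane} {T : ℝ}
    (hγ : IsStrictlyConvexStarShapedClosedCurve γ T) {s t : ℝ} (hst : s < t)
    (h : ∀ x ∈ Set.Icc s t, ¬ IsKeplerVertex γ x) :
    Disjoint (oscOrbit γ s) (oscOrbit γ t) ∧ AreNested (oscOrbit γ s) (oscOrbit γ t) := by
  obtain ⟨ε, hε, hε'⟩ := exists_sign_of_continuousOn isPreconnected_Icc
    (continuous_deriv_oscK hγ).continuousOn
    fun x hx h0 => h x hx (isKeplerVertex_of_deriv_eq_zero hγ h0)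
  have hlt (p : Plane) (hp : p ≠ 0) := oscGauge_lt hγ hst hε' hp
  rcases hε with rfl | rfl
  · exact disjoint_and_areNested_of_keplerGauge_lt (hγ.oscK_pos s) (hγ.oscK_pos t)
      fun p hp => by simpa using hlt p hp
  · have := disjoint_and_areNested_of_keplerGauge_lt (hγ.oscK_pos t) (hγ.oscK_pos s)
      fun p hp => by simpa using hlt p hp
    exact ⟨this.1.symm, this.2.symm⟩

/-! ### Periodicity -/

theorem periodic_iteratedDeriv {γ : ℝ → Plane} {T : ℝ} (h : Function.Periodic γ T) (n : ℕ) :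
    Function.Periodic (iteratedDeriv n γ) T := fun t => by
  rw [← congrFun (iteratedDeriv_comp_add_const n γ T) t, show (fun z => γ (z + T)) = γ from funext h]

theorem periodic_posDet {γ : ℝ → Plane} {T : ℝ} (h : Function.Periodic γ T) (j : ℕ) :
    Function.Periodic (posDet γ j) T := fun t => by
  simp only [posDet, h t, periodic_iteratedDeriv h j t]

theorem periodic_oscK {γ : ℝ → Plane} {T : ℝ} (h : Function.Periodic γ T) :
    Function.Periodic (oscK γ) T := fun t => by
  simp only [oscK, velDet, h t, periodic_iteratedDeriv h _ t, periodic_posDet h _ t]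

theorem periodic_oscA {γ : ℝ → Plane} {T : ℝ} (h : Function.Periodic γ T) :
    Function.Periodic (oscA γ) T := fun t => by
  simp only [oscA, h t, periodic_iteratedDeriv h _ t, periodic_posDet h _ t, periodic_oscK h t]

theorem periodic_oscB {γ : ℝ → Plane} {T : ℝ} (h : Function.Periodic γ T) :
    Function.Periodic (oscB γ) T := fun t => by
  simp only [oscB, h t, periodic_iteratedDeriv h _ t, periodic_posDet h _ t, periodic_oscK h t]

theorem periodic_deriv_oscK {γ : ℝ → Plane} {T : ℝ} (h : Function.Periodic γ T) :
    Function.Periodic (deriv (oscK γ)) T := fun t => by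
  rw [← deriv_comp_add_const, show (fun z => oscK γ (z + T)) = oscK γ from
    funext (periodic_oscK h)]

/-! ### The polar angle -/

/-- A polar angle along the curve, measured in the direction `ε = ±1` in which the curve turns. -/
structure IsPolarAngle (γ : ℝ → Plane) (ε : ℝ) (θ : ℝ → ℝ) : Prop where
  sign : ε ^ 2 = 1
  continuous : Continuous θ
  strictMono : StrictMono θ
  apply_zero : ∀ t, γ t 0 / ‖γ t‖ = Real.cos (θ t)
  apply_one : ∀ t, γ t 1 / ‖γ t‖ = ε * Real.sin (θ t)

theorem exists_isPolarAngle {γ : ℝ → Plane} {T : ℝ}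
    (hγ : IsStrictlyConvexStarShapedClosedCurve γ T) :
    ∃ ε θ L, IsPolarAngle γ ε θ ∧ ∀ t, θ (t + T) = θ t + L := by
  have hw := hγ.posDet_ne_zero
  have h0 (t) := norm_pos_of_posDet_ne_zero (hw t)
  have hu (x) : (γ x 0 / ‖γ x‖) ^ 2 + (γ x 1 / ‖γ x‖) ^ 2 = 1 := by
    have h := h0 x
    field_simp
    exact (Plane.norm_sq _).symm
  have hwc : Continuous (posDet γ 1) := continuous_iff_continuousAt.2
    fun t => (hasDerivAt_posDet hγ.smooth t).continuousAt
  obtain ⟨ε, hε, hpos⟩ := exists_sign_of_continuousOn isPreconnected_univ hwc.continuousOn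
    fun x _ => hw x
  have hε2 : ε ^ 2 = 1 := by rcases hε with rfl | rfl <;> norm_num
  -- the initial angle
  obtain ⟨θ₀, hθ₀c, hθ₀s⟩ : ∃ θ₀, Real.cos θ₀ = γ 0 0 / ‖γ 0‖ ∧
      Real.sin θ₀ = ε * (γ 0 1 / ‖γ 0‖) := by
    set z : ℂ := ⟨γ 0 0 / ‖γ 0‖, ε * (γ 0 1 / ‖γ 0‖)⟩ with hz
    have hz1 : ‖z‖ = 1 := by
      rw [← sq_eq_sq₀ (norm_nonneg _) zero_le_one, ← Complex.normSq_eq_norm_sq, Complex.normSq_apply]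
      simp only [hz]
      linear_combination hu 0 + (γ 0 1 / ‖γ 0‖) ^ 2 * hε2
    have hz0 : z ≠ 0 := norm_ne_zero_iff.1 (by rw [hz1]; exact one_ne_zero)
    exact ⟨z.arg, by rw [Complex.cos_arg hz0, hz1, div_one], by rw [Complex.sin_arg, hz1, div_one]⟩
  set ν : ℝ → ℝ := fun t => ε * (posDet γ 1 t / ‖γ t‖ ^ 2) with hν
  have hνc : Continuous ν := continuous_const.mul
    (hwc.div (hγ.smooth.continuous.norm.pow 2) fun t => pow_ne_zero 2 (h0 t).ne')
  have hνp : Function.Periodic ν T := fun t => by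
    simp only [hν, periodic_posDet hγ.periodic 1 t, hγ.periodic t]
  set θ : ℝ → ℝ := fun t => θ₀ + ∫ x in (0 : ℝ)..t, ν x with hθ
  have hθd (t) : HasDerivAt θ (ν t) t := (intervalIntegral.integral_hasDerivAt_right
    (hνc.intervalIntegrable _ _) (hνc.stronglyMeasurableAtFilter _ _) hνc.continuousAt).const_add θ₀
  have hθc : Continuous θ := continuous_iff_continuousAt.2 fun t => (hθd t).continuousAt
  have hmono : StrictMono θ := strictMono_of_deriv_pos fun t => by
    rw [(hθd t).deriv]
    have := mul_pos (hpos t trivial) (inv_pos.2 (pow_pos (h0 t) 2))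
    simpa only [hν, div_eq_mul_inv, mul_assoc] using this
  -- The inner product of `u` and `(cos θ, ε sin θ)` is constant.
  have hA (t) : γ t 0 / ‖γ t‖ * Real.cos (θ t) + γ t 1 / ‖γ t‖ * (ε * Real.sin (θ t)) = 1 := by
    have hd (t) := ((hasDerivAt_apply_zero_div_norm hγ.smooth (h0 t)).mul (hθd t).cos).add
      ((hasDerivAt_apply_one_div_norm hγ.smooth (h0 t)).mul ((hθd t).sin.const_mul ε))
    have hconst := is_const_of_deriv_eq_zero (fun t => (hd t).differentiableAt) (fun t => by
      rw [(hd t).deriv]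
      simp only [hν]
      linear_combination posDet γ 1 t / ‖γ t‖ ^ 2 * (γ t 1 / ‖γ t‖) * Real.cos (θ t) * hε2) t 0
    refine hconst.trans ?_
    have : θ 0 = θ₀ := by simp [hθ]
    simp only [Pi.add_apply, Pi.mul_apply, this, hθ₀c, hθ₀s]
    linear_combination hu 0 + (γ 0 1 / ‖γ 0‖) ^ 2 * hε2
  have hsq (t) : (γ t 0 / ‖γ t‖ - Real.cos (θ t)) ^ 2 +
      (γ t 1 / ‖γ t‖ - ε * Real.sin (θ t)) ^ 2 = 0 := by
    linear_combination hu t - 2 * hA t + Real.cos_sq_add_sin_sq (θ t) + Real.sin (θ t) ^ 2 * hε2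
  refine ⟨ε, θ, ∫ x in (0 : ℝ)..0 + T, ν x, ⟨hε2, hθc, hmono, fun t => ?_, fun t => ?_⟩, fun t => ?_⟩
  · have := hsq t
    nlinarith [sq_nonneg (γ t 0 / ‖γ t‖ - Real.cos (θ t)),
      sq_nonneg (γ t 1 / ‖γ t‖ - ε * Real.sin (θ t))]
  · have := hsq t
    nlinarith [sq_nonneg (γ t 0 / ‖γ t‖ - Real.cos (θ t)),
      sq_nonneg (γ t 1 / ‖γ t‖ - ε * Real.sin (θ t))]
  · simp only [hθ]
    rw [← hνp.intervalIntegral_add_eq t 0, add_assoc, intervalIntegral.integral_add_adjacent_intervals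
      (hνc.intervalIntegrable _ _) (hνc.intervalIntegrable _ _)]

/-- A simple closed curve has no double points at parameters less than a period apart. -/
theorem ne_of_lt_of_lt_add_period {γ : ℝ → Plane} {T : ℝ}
    (hγ : IsStrictlyConvexStarShapedClosedCurve γ T) {s t : ℝ} (hst : s < t) (hts : t < s + T) :
    γ s ≠ γ t := by
  intro h
  have hT := hγ.period_pos
  have key (x : ℝ) : ∃ n : ℤ, x - n * T ∈ Set.Ico 0 T ∧ γ (x - n * T) = γ x :=
    ⟨⌊x / T⌋, ⟨Int.sub_floor_div_mul_nonneg x hT, Int.sub_floor_div_mul_lt x hT⟩, hγ.periodic.sub_int_mul_eq _⟩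
  obtain ⟨m, hm, hm'⟩ := key s
  obtain ⟨n, hn, hn'⟩ := key t
  have he := hγ.simple hm hn (by rw [hm', hn', h])
  have h1 : ((n - m : ℤ) : ℝ) * T = t - s := by push_cast; linarith
  have h2 : (0 : ℝ) < (n - m : ℤ) := by
    by_contra! hle
    nlinarith
  have h3 : (1 : ℝ) ≤ (n - m : ℤ) := by exact_mod_cast Int.cast_pos.1 h2
  nlinarith

/-- A simple curve winds around the origin at most once. If the angle gained more than `2π` in a
period, then comparing the distances to the origin at the angles `φ` and `φ + 2π`, with `φ` or
`φ + 2π` the angle of a point farthest from the origin, and applying the intermediate value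
theorem would give a double point. -/
theorem IsPolarAngle.le_two_pi {γ : ℝ → Plane} {T : ℝ}
    (hγ : IsStrictlyConvexStarShapedClosedCurve γ T) {ε L : ℝ} {θ : ℝ → ℝ}
    (hθ : IsPolarAngle γ ε θ) (hL : ∀ t, θ (t + T) = θ t + L) : L ≤ 2 * Real.pi := by
  by_contra! hlt
  have hpi := Real.pi_pos
  have hTpos := hγ.period_pos
  have h0 (t) := norm_pos_of_posDet_ne_zero (hγ.posDet_ne_zero t)
  have hsurj : Function.Surjective θ := by
    have hn (n : ℤ) : θ (n * T) = θ 0 + n * L := by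
      have hp : Function.Periodic (fun t => θ t - L / T * t) T := fun t => by
        simp only [hL]
        field_simp
        ring
      have := hp.int_mul n 0
      simp only [zero_add, mul_zero, sub_zero] at this
      field_simp at this
      linarith
    intro y
    obtain ⟨n, hn1⟩ := exists_nat_gt (|y - θ 0| / L)
    rw [div_lt_iff₀ (by linarith)] at hn1
    have hy := abs_lt.1 hn1
    refine mem_range_of_exists_le_of_exists_ge hθ.continuous ⟨((-n : ℤ) : ℝ) * T, ?_⟩
      ⟨((n : ℤ) : ℝ) * T, ?_⟩
    · rw [hn]
      push_cast
      linarith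
    · rw [hn]
      push_cast
      linarith
  set e := hθ.strictMono.orderIsoOfSurjective θ hsurj with he
  have heθ (φ) : θ (e.symm φ) = φ := e.apply_symm_apply φ
  have hec : Continuous e.symm := e.symm.continuous
  obtain ⟨t₀, ht₀⟩ := exists_forall_le_of_periodic hγ.smooth.continuous.norm hTpos
    fun s => by rw [hγ.periodic s]
  set d : ℝ → ℝ := fun φ => ‖γ (e.symm (φ + 2 * Real.pi))‖ - ‖γ (e.symm φ)‖ with hd
  have hdc : Continuous d :=
    (hγ.smooth.continuous.comp (hec.comp (continuous_add_const _))).norm.sub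
      (hγ.smooth.continuous.comp hec).norm
  have het : e.symm (θ t₀) = t₀ := e.symm_apply_apply t₀
  obtain ⟨φ, hφ⟩ := mem_range_of_exists_le_of_exists_ge hdc (c := 0)
    ⟨θ t₀, by simp only [hd, het]; linarith [ht₀ (e.symm (θ t₀ + 2 * Real.pi))]⟩
    ⟨θ t₀ - 2 * Real.pi, by
      simp only [hd, sub_add_cancel, het]; linarith [ht₀ (e.symm (θ t₀ - 2 * Real.pi))]⟩
  have hr : ‖γ (e.symm (φ + 2 * Real.pi))‖ = ‖γ (e.symm φ)‖ := sub_eq_zero.1 hφ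
  refine ne_of_lt_of_lt_add_period hγ (s := e.symm φ) (t := e.symm (φ + 2 * Real.pi))
    (e.symm.strictMono (by linarith)) ?_ ?_
  · rw [← hθ.strictMono.lt_iff_lt, hL, heθ, heθ]
    linarith
  · have h1 := h0 (e.symm φ)
    have c0 := hθ.apply_zero (e.symm φ)
    have c1 := hθ.apply_zero (e.symm (φ + 2 * Real.pi))
    have s0 := hθ.apply_one (e.symm φ)
    have s1 := hθ.apply_one (e.symm (φ + 2 * Real.pi))
    rw [hr, heθ, Real.cos_add_two_pi] at c1
    rw [hr, heθ, Real.sin_add_two_pi] at s1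
    rw [heθ] at c0 s0
    ext i
    fin_cases i
    · exact (div_left_inj' h1.ne').1 (c0.trans c1.symm)
    · exact (div_left_inj' h1.ne').1 (s0.trans s1.symm)

/-! ### Four vertices -/

theorem IsPolarAngle.sin_half_sub_pos {γ : ℝ → Plane} {T : ℝ}
    (hγ : IsStrictlyConvexStarShapedClosedCurve γ T) {ε L : ℝ} {θ : ℝ → ℝ}
    (hθ : IsPolarAngle γ ε θ) (hL : ∀ t, θ (t + T) = θ t + L) {s t : ℝ} (hst : s < t)
    (hts : t < s + T) : 0 < Real.sin ((θ t - θ s) / 2) := by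
  have h1 := hθ.strictMono hst
  have h2 := hθ.strictMono hts
  have h3 := hθ.le_two_pi hγ hL
  rw [hL] at h2
  exact Real.sin_pos_of_pos_of_lt_pi (by linarith) (by linarith)

theorem IsPolarAngle.sin_half_sub_neg {γ : ℝ → Plane} {T : ℝ}
    (hγ : IsStrictlyConvexStarShapedClosedCurve γ T) {ε L : ℝ} {θ : ℝ → ℝ}
    (hθ : IsPolarAngle γ ε θ) (hL : ∀ t, θ (t + T) = θ t + L) {s t : ℝ} (hst : s < t)
    (hts : t < s + T) : Real.sin ((θ s - θ t) / 2) < 0 := by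
  have := hθ.sin_half_sub_pos hγ hL hst hts
  rwa [← neg_pos, ← Real.sin_neg, ← neg_div, neg_sub]

/-- The derivative of `oscK` times a trigonometric polynomial of degree at most one in the polar
angle has a periodic primitive, because `(a, b)' = k' • γ / ‖γ‖`. Such a polynomial is given here
by its two zeros, the angles of `γ p` and `γ q`. -/
theorem IsPolarAngle.exists_periodic_primitive {γ : ℝ → Plane} {T : ℝ}
    (hγ : IsStrictlyConvexStarShapedClosedCurve γ T) {ε : ℝ} {θ : ℝ → ℝ}
    (hθ : IsPolarAngle γ ε θ) (p q : ℝ) :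
    ∃ N : ℝ → ℝ, Function.Periodic N T ∧ ∀ t, HasDerivAt N
      (deriv (oscK γ) t * (Real.sin ((θ t - θ p) / 2) * Real.sin ((θ t - θ q) / 2))) t := by
  have hw := hγ.posDet_ne_zero
  refine ⟨fun t => (Real.cos ((θ p - θ q) / 2) * oscK γ t - (Real.cos ((θ p + θ q) / 2) * oscA γ t +
    ε * Real.sin ((θ p + θ q) / 2) * oscB γ t)) / 2, fun t => ?_, fun t => ?_⟩
  · simp only [periodic_oscK hγ.periodic t, periodic_oscA hγ.periodic t,
      periodic_oscB hγ.periodic t]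
  · refine ((((hasDerivAt_oscK hγ.smooth hw t).const_mul _).sub
      (((hasDerivAt_oscA hγ.smooth hw t).const_mul _).add
        ((hasDerivAt_oscB hγ.smooth hw t).const_mul _))).div_const 2).congr_deriv ?_
    rw [hθ.apply_zero, hθ.apply_one]
    have h1 : Real.cos ((θ p - θ q) / 2) = Real.cos ((θ t - θ q) / 2 - (θ t - θ p) / 2) := by
      congr 1
      ring
    have h2 : Real.cos (θ t - (θ p + θ q) / 2) =
        Real.cos ((θ t - θ q) / 2 + (θ t - θ p) / 2) := by
      congr 1
      ring
    rw [Real.cos_sub] at h1 h2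
    rw [Real.cos_add] at h2
    linear_combination deriv (oscK γ) t / 2 * (h1 - h2) -
      deriv (oscK γ) t / 2 * Real.sin ((θ p + θ q) / 2) * Real.sin (θ t) * hθ.sign

theorem mul_lt_mul_of_hasDerivAt {N g : ℝ → ℝ} (hN : ∀ t, HasDerivAt N (g t) t) {c s t : ℝ}
    (hst : s < t) (h : ∀ x ∈ Set.Ioo s t, 0 < c * g x) : c * N s < c * N t := by
  refine strictMonoOn_of_deriv_pos (convex_Icc s t) (f := fun x => c * N x)
    (fun x _ => ((hN x).const_mul c).continuousAt.continuousWithinAt) (fun x hx => ?_)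
    (Set.left_mem_Icc.2 hst.le) (Set.right_mem_Icc.2 hst.le) hst
  rw [((hN x).const_mul c).deriv]
  exact h x (by rwa [interior_Icc] at hx)

/-- The derivative of `oscK` has a zero off any three points of a period. Otherwise it has constant
sign on each of the three complementary arcs. Two of these signs agree, so the sign pattern is that
of a constant or of a trigonometric polynomial of degree one that vanishes at the two ends of the
remaining arc; the product with this polynomial would be the derivative of a strictly monotone
periodic function. -/
theorem not_deriv_oscK_ne_zero_of_three {γ : ℝ → Plane} {T : ℝ}
    (hγ : IsStrictlyConvexStarShapedClosedCurve γ T) {p₀ p₁ p₂ : ℝ} (h₀₁ : p₀ < p₁) (h₁₂ : p₁ < p₂)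
    (h₂ : p₂ < p₀ + T) (hA : ∀ x ∈ Set.Ioo p₀ p₁, deriv (oscK γ) x ≠ 0)
    (hB : ∀ x ∈ Set.Ioo p₁ p₂, deriv (oscK γ) x ≠ 0)
    (hC : ∀ x ∈ Set.Ioo p₂ (p₀ + T), deriv (oscK γ) x ≠ 0) : False := by
  obtain ⟨ε, θ, L, hθ, hL⟩ := exists_isPolarAngle hγ
  have hc := continuous_deriv_oscK hγ
  obtain ⟨a, ha, hA⟩ := exists_sign_of_continuousOn isPreconnected_Ioo hc.continuousOn hA
  obtain ⟨b, hb, hB⟩ := exists_sign_of_continuousOn isPreconnected_Ioo hc.continuousOn hB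
  obtain ⟨c, hc, hC⟩ := exists_sign_of_continuousOn isPreconnected_Ioo hc.continuousOn hC
  have contra {N g : ℝ → ℝ} (hN : Function.Periodic N T) (hd : ∀ t, HasDerivAt N (g t) t) (σ : ℝ)
      (h1 : ∀ x ∈ Set.Ioo p₀ p₁, 0 < σ * g x) (h2 : ∀ x ∈ Set.Ioo p₁ p₂, 0 < σ * g x)
      (h3 : ∀ x ∈ Set.Ioo p₂ (p₀ + T), 0 < σ * g x) : False := by
    have i1 := mul_lt_mul_of_hasDerivAt hd h₀₁ h1
    have i2 := mul_lt_mul_of_hasDerivAt hd h₁₂ h2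
    have i3 := mul_lt_mul_of_hasDerivAt hd h₂ h3
    rw [hN p₀] at i3
    linarith
  have pos {s t : ℝ} (h : s < t) (h' : t < s + T) := hθ.sin_half_sub_pos hγ hL h h'
  have neg {s t : ℝ} (h : s < t) (h' : t < s + T) := hθ.sin_half_sub_neg hγ hL h h'
  have combine {σ τ x y z : ℝ} (h : 0 < τ * x) (hστ : σ = τ) (hyz : 0 < y * z) :
      0 < σ * (x * (y * z)) := by
    rw [hστ, ← mul_assoc]
    exact mul_pos h hyz
  have combine' {σ τ x y z : ℝ} (h : 0 < τ * x) (hστ : σ = -τ) (hyz : y * z < 0) :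
      0 < σ * (x * (y * z)) := by
    rw [hστ, ← mul_assoc, neg_mul]
    exact mul_pos_of_neg_of_neg (neg_neg_of_pos h) hyz
  have opp {x y : ℝ} (hx : x = 1 ∨ x = -1) (hy : y = 1 ∨ y = -1) (h : x ≠ y) : x = -y :=
    (sq_eq_sq_iff_eq_or_eq_neg.1 ((sq_eq_one_iff.2 hx).trans
      (sq_eq_one_iff.2 hy).symm)).resolve_left h
  by_cases hab : a = b
  · by_cases hbc : b = c
    · subst hab hbc
      exact contra (periodic_oscK hγ.periodic) (hasDerivAt_oscK hγ.smooth hγ.posDet_ne_zero) a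
        hA hB hC
    · subst hab
      obtain ⟨N, hN, hd⟩ := hθ.exists_periodic_primitive hγ p₀ p₂
      have hca := opp hc ha (Ne.symm hbc)
      refine contra hN hd c (fun x hx => ?_) (fun x hx => ?_) fun x hx => ?_ <;>
        obtain ⟨hx1, hx2⟩ := hx
      · exact combine' (hA x ⟨hx1, hx2⟩) hca (mul_neg_of_pos_of_neg
          (pos (by linarith) (by linarith)) (neg (by linarith) (by linarith)))
      · exact combine' (hB x ⟨hx1, hx2⟩) hca (mul_neg_of_pos_of_neg
          (pos (by linarith) (by linarith)) (neg (by linarith) (by linarith)))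
      · exact combine (hC x ⟨hx1, hx2⟩) rfl (mul_pos
          (pos (by linarith) (by linarith)) (pos (by linarith) (by linarith)))
  · by_cases hbc : b = c
    · subst hbc
      obtain ⟨N, hN, hd⟩ := hθ.exists_periodic_primitive hγ p₀ p₁
      refine contra hN hd b (fun x hx => ?_) (fun x hx => ?_) fun x hx => ?_ <;>
        obtain ⟨hx1, hx2⟩ := hx
      · exact combine' (hA x ⟨hx1, hx2⟩) (opp hb ha (Ne.symm hab)) (mul_neg_of_pos_of_neg
          (pos (by linarith) (by linarith)) (neg (by linarith) (by linarith)))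
      · exact combine (hB x ⟨hx1, hx2⟩) rfl (mul_pos
          (pos (by linarith) (by linarith)) (pos (by linarith) (by linarith)))
      · exact combine (hC x ⟨hx1, hx2⟩) rfl (mul_pos
          (pos (by linarith) (by linarith)) (pos (by linarith) (by linarith)))
    · obtain ⟨N, hN, hd⟩ := hθ.exists_periodic_primitive hγ p₁ p₂
      have hac : a = c := by
        rw [opp ha hb hab, opp hc hb (Ne.symm hbc)]
      refine contra hN hd a (fun x hx => ?_) (fun x hx => ?_) fun x hx => ?_ <;>
        obtain ⟨hx1, hx2⟩ := hx
      · exact combine (hA x ⟨hx1, hx2⟩) rfl (mul_pos_of_neg_of_neg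
          (neg (by linarith) (by linarith)) (neg (by linarith) (by linarith)))
      · exact combine' (hB x ⟨hx1, hx2⟩) (opp ha hb hab) (mul_neg_of_pos_of_neg
          (pos (by linarith) (by linarith)) (neg (by linarith) (by linarith)))
      · exact combine (hC x ⟨hx1, hx2⟩) hac (mul_pos
          (pos (by linarith) (by linarith)) (pos (by linarith) (by linarith)))

theorem four_le_encard_keplerVertices {γ : ℝ → Plane} {T : ℝ}
    (hγ : IsStrictlyConvexStarShapedClosedCurve γ T) :
    4 ≤ (γ '' {t | IsKeplerVertex γ t}).encard := by
  by_contra! hlt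
  have hT := hγ.period_pos
  set Z : Set ℝ := {t | t ∈ Set.Ico 0 T ∧ deriv (oscK γ) t = 0} with hZ
  have hZT : Z ⊆ Set.Ico 0 T := fun t ht => ht.1
  have hZ3 : Z.encard ≤ 3 := by
    refine Order.le_of_lt_add_one (lt_of_le_of_lt ?_ hlt)
    rw [← (hγ.simple.mono hZT).encard_image]
    exact Set.encard_le_encard
      (Set.image_mono fun t ht => isKeplerVertex_of_deriv_eq_zero hγ ht.2)
  obtain ⟨S, hZS, hST, hS⟩ := Set.exists_superset_subset_encard_eq hZT hZ3
    (by rw [(Set.Ico_infinite hT).encard_eq]; exact le_top)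
  have hfin : S.Finite := Set.finite_of_encard_eq_coe (k := 3) hS
  have hcard : hfin.toFinset.card = 3 := by
    rw [hfin.encard_eq_coe_toFinset_card] at hS
    exact_mod_cast hS
  set p := hfin.toFinset.orderEmbOfFin hcard with hp
  have hpS (x) (hx : x ∈ S) : x = p 0 ∨ x = p 1 ∨ x = p 2 := by
    have : x ∈ Set.range p := by simpa [hp] using hx
    obtain ⟨i, rfl⟩ := this
    fin_cases i <;> simp
  have hpT (i) : p i ∈ Set.Ico 0 T :=
    hST (hfin.mem_toFinset.1 (Finset.orderEmbOfFin_mem _ hcard i))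
  have h01 : p 0 < p 1 := p.strictMono (by decide)
  have h12 : p 1 < p 2 := p.strictMono (by decide)
  have hne (x) (hx : x ∈ Set.Ico 0 T) (h0 : x ≠ p 0) (h1 : x ≠ p 1) (h2 : x ≠ p 2) :
      deriv (oscK γ) x ≠ 0 := fun h => by
    rcases hpS x (hZS ⟨hx, h⟩) with h | h | h <;> contradiction
  have b0 := hpT 0
  have b1 := hpT 1
  have b2 := hpT 2
  rw [Set.mem_Ico] at b0 b1 b2
  refine not_deriv_oscK_ne_zero_of_three hγ h01 h12 (by linarith) (fun x hx => ?_) (fun x hx => ?_)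
    fun x hx => ?_ <;> obtain ⟨hx1, hx2⟩ := hx
  · exact hne x ⟨by linarith, by linarith⟩ hx1.ne' hx2.ne (by linarith)
  · exact hne x ⟨by linarith, by linarith⟩ (by linarith) hx1.ne' hx2.ne
  · rcases lt_or_ge x T with hxT | hxT
    · exact hne x ⟨by linarith, hxT⟩ (by linarith) (by linarith) hx1.ne'
    · rw [← (periodic_deriv_oscK hγ.periodic).sub_eq x]
      refine hne (x - T) ⟨by linarith, by linarith⟩ ?_ ?_ ?_ <;> apply ne_of_lt <;> linarith

theorem mainTheorem8 (γ : ℝ → Plane) (T : ℝ)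
    (hγ : IsStrictlyConvexStarShapedClosedCurve γ T) :
    -- every point of the curve has a unique osculating Kepler orbit
    (∀ t, ∃! C, IsOsculatingKeplerOrbit γ t C) ∧
    -- at least four points of the curve are Kepler vertices
    4 ≤ (γ '' {t | IsKeplerVertex γ t}).encard ∧
    -- along a vertex-free arc the osculating Kepler orbits are pairwise disjoint and nested
    ∀ I : Set ℝ, I.OrdConnected → (∀ t ∈ I, ¬ IsKeplerVertex γ t) →
      ∀ s ∈ I, ∀ t ∈ I, s ≠ t → ∀ C D : Set Plane,
        IsOsculatingKeplerOrbit γ s C → IsOsculatingKeplerOrbit γ t D →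
          Disjoint C D ∧ AreNested C D := by
  refine ⟨fun t => ⟨oscOrbit γ t, (isOsculatingKeplerOrbit_iff hγ).2 rfl,
    fun C hC => (isOsculatingKeplerOrbit_iff hγ).1 hC⟩, four_le_encard_keplerVertices hγ, ?_⟩
  intro I hI hv s hs t ht hst C D hC hD
  rw [(isOsculatingKeplerOrbit_iff hγ).1 hC, (isOsculatingKeplerOrbit_iff hγ).1 hD]
  rcases lt_or_gt_of_ne hst with h | h
  · exact oscOrbit_disjoint_and_areNested hγ h fun x hx => hv x (hI.out hs ht hx)
  · have := oscOrbit_disjoint_and_areNested hγ h fun x hx => hv x (hI.out ht hs hx)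
    exact ⟨this.1.symm, this.2.symm⟩
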